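/- Consider a cache-enabled fog radio access network in the plane $\mathbb{R}^2$ with a typical user at the origin. There are three tiers of base stations: F-APs holding the requested content ($F_c$), F-APs not holding it ($\tilde F_c$), and RRHs ($R$). They form independent homogeneous Poisson point processes $\Phi_{F_c},\Phi_{\tilde F_c},\Phi_R$ with densities $\lambda_{F_c}=p_{hit}\lambda_F$, $\lambda_{\tilde F_c}=(1-p_{hit})\lambda_F$ and $\lambda_R$, where $\lambda_F,\lambda_R>0$ and $p_{hit}=\sum_{i=1}^{M} i^{-\tau}/\sum_{j=1}^{N} j^{-\tau}$ with $\tau\ge 0$ and $1\le M<N$. The transmit powers are $P_{F_c}=P_{\tilde F_c}=P_F>0$ and $P_R>0$, the path loss exponent is $\alpha>2$, the noise variance is $\sigma^2\ge 0$, and the channel gains $|h_x|^2$ are i.i.d. exponential with mean $1$ and independent of the positions. Let $B\ge 0$ and $N_B\ge 2$ be integers (number of feedback bits, number of RRH antennas), let $\zeta=1-2^B\beta\big(2^B,\tfrac{N_B}{N_B-1}\big)$ with $\beta$ the Beta function, and let $\upsilon=2^{-B/(N_B-1)}$. With $r_x$ the distance from $x$ to the origin, write $\Phi_F=\Phi_{F_c}\cup\Phi_{\tilde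 F_c}$ and $W_x=P_F|h_x|^2r_x^{-\alpha}$ for $x\in\Phi_F$, $W_x=P_R|h_x|^2r_x^{-\alpha}$ for $x\in\Phi_R$. The SINR of the user at $x$ is $$\gamma_x=\frac{W_x}{\sum_{z\in\Phi_F\setminus\{x\}}W_z+\sum_{y\in\Phi_R}W_y+\sigma^2}\quad(x\in\Phi_F),\qquad \gamma_x=\frac{\zeta W_x}{\sum_{z\in\Phi_F}W_z+\upsilon\sum_{y\in\Phi_R\setminus\{x\}}W_y+\sigma^2}\quad(x\in\Phi_R).$$ For thresholds $\eta_i$, $i\in\{F_c,\tilde F_c,R\}$, let $$S(\{\eta_i\},\alpha)=\mathbb{P}\Big(\bigcup_{i}\bigcup_{x\in\Phi_i}\{\gamma_x>\eta_i\}\Big)$$ be the success probability of the minimal-delay association policy, and let $S(\eta,\alpha)$ be its value when all $\eta_i=\eta$. Then almost surely $\gamma_x$ attains a finite maximum over all base stations, and the average ergodic rate of the minimal-delay policy satisfies, as an identity in $[0,\infty]$, $$R(\alpha)=\mathbb{E}\Big[\log_2\big(1+\max_{x}\gamma_x\big)\Big]=\int_0^\infty \mathbb{P}\Big[\max_x\gamma_x\ge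 2^t-1\Big]\,dt=\int_0^\infty S(2^t-1,\alpha)\,dt .$$ -/

import Mathlib

open MeasureTheory ProbabilityTheory Set
open scoped ENNReal

namespace FRAN

noncomputable section

/-- The plane in which the base stations are deployed; the typical user sits at the origin. -/
abbrev Plane : Type := EuclideanSpace ℝ (Fin 2)

/-- The three classes of base stations: F-APs with the requested content, F-APs without it, and
RRHs. -/
inductive Tier : Type
  | cached
  | uncached
  | rrh

/-- A base station: its tier together with its number in the enumeration of that tier. -/
abbrev BS : Type := Tier × ℕ

/-- The Zipf popularity `f_i(τ, N) = i^{-τ} / ∑_{j=1}^N j^{-τ}` of the `i`-th most popular of `N`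
contents. -/
def zipf (τ : ℝ) (N i : ℕ) : ℝ :=
  (1 / (i : ℝ) ^ τ) / ∑ j ∈ Finset.Icc 1 N, 1 / (j : ℝ) ^ τ

/-- The parameters of a cache-enabled fog radio access network, with their standing ranges. -/
structure Params where
  /-- density of the F-APs -/
  lamF : ℝ
  /-- density of the RRHs -/
  lamR : ℝ
  /-- transmit power of the F-APs -/
  powF : ℝ
  /-- transmit power of the RRHs -/
  powR : ℝ
  /-- path loss exponent -/
  α : ℝ
  /-- noise variance `σ²` (the value `0` is the interference-limited network) -/
  noise : ℝ
  /-- Zipf exponent -/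
  τ : ℝ
  /-- number of contents in the database -/
  N : ℕ
  /-- number of contents cached at each F-AP -/
  M : ℕ
  /-- number of feedback bits -/
  B : ℕ
  /-- number of antennas at each RRH -/
  NB : ℕ
  lamF_pos : 0 < lamF
  lamR_pos : 0 < lamR
  powF_pos : 0 < powF
  powR_pos : 0 < powR
  two_lt_α : 2 < α
  noise_nonneg : 0 ≤ noise
  τ_nonneg : 0 ≤ τ
  one_le_M : 1 ≤ M
  M_lt_N : M < N
  two_le_NB : 2 ≤ NB

namespace Params

variable (p : Params)

/-- The caching hit probability when the `M` most popular contents are cached. -/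
def hitProb : ℝ := ∑ i ∈ Finset.Icc 1 p.M, zipf p.τ p.N i

/-- The density of each tier. -/
def density : Tier → ℝ
  | .cached => p.hitProb * p.lamF
  | .uncached => (1 - p.hitProb) * p.lamF
  | .rrh => p.lamR

/-- The transmit power in each tier. -/
def txPower : Tier → ℝ
  | .cached => p.powF
  | .uncached => p.powF
  | .rrh => p.powR

/-- The quantized coefficient `ζ = 1 - L β(L, N_B / (N_B - 1))`, with codebook size `L = 2^B`. -/
def ζ : ℝ :=
  1 - (2 : ℝ) ^ p.B * ProbabilityTheory.beta ((2 : ℝ) ^ p.B) ((p.NB : ℝ) / ((p.NB : ℝ) - 1))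

/-- The residual interference coefficient `υ = 2^{-B / (N_B - 1)}`. -/
def υ : ℝ := (2 : ℝ) ^ (-((p.B : ℝ) / ((p.NB : ℝ) - 1)))

/-- The factor multiplying the received power of a serving base station: `ζ` for an RRH, `1` for
an F-AP. -/
def signalGain : Tier → ℝ
  | .rrh => p.ζ
  | _ => 1

/-- The factor multiplying the received power of an interfering base station of the second tier
when the user is served by the first tier: `υ` between two RRHs, `1` otherwise. -/
def coupling : Tier → Tier → ℝ
  | .rrh, .rrh => p.υ
  | _, _ => 1

end Params

/-- The random points `X 0, X 1, …` enumerate a Poisson point process with intensity measure `ν`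
on the plane: for pairwise disjoint bounded Borel sets, the numbers of points in them are
independent and have the Poisson laws with means the `ν`-measures of the sets. -/
structure IsPoissonProcess {Ω : Type*} [MeasurableSpace Ω] (X : ℕ → Ω → Plane) (ν : Measure Plane)
    (P : Measure Ω) : Prop where
  measurable : ∀ n, Measurable (X n)
  law : ∀ (m : ℕ) (A : Fin m → Set Plane) (k : Fin m → ℕ),
    (∀ j, MeasurableSet (A j)) → (∀ j, Bornology.IsBounded (A j)) →
    Pairwise (fun i j => Disjoint (A i) (A j)) →
    P {ω | ∀ j, {n | X n ω ∈ A j}.encard = (k j : ℕ∞)} =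
      ∏ j, poissonMeasure (ν (A j)).toNNReal {k j}

/-- The random network: in each tier the base stations (at positions `X i n`) form a homogeneous
Poisson point process with the density of the tier, the three processes are independent, and the
channel gains `g i n = |h|²` are i.i.d. exponential with mean `1`, independent of the positions. -/
structure IsNetwork (p : Params) {Ω : Type*} [MeasurableSpace Ω] (X : Tier → ℕ → Ω → Plane)
    (g : Tier → ℕ → Ω → ℝ) (P : Measure Ω) : Prop where
  poisson : ∀ i, IsPoissonProcess (X i) (ENNReal.ofReal (p.density i) • volume) P
  indep_tiers : iIndepFun (fun (i : Tier) (ω : Ω) (n : ℕ) => X i n ω) P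
  gain_measurable : ∀ i n, Measurable (g i n)
  gain_law : ∀ i n, P.map (g i n) = expMeasure 1
  indep_gains : iIndepFun (fun (b : BS) (ω : Ω) => g b.1 b.2 ω) P
  indep_gains_positions :
    IndepFun (fun ω (i : Tier) (n : ℕ) => X i n ω) (fun ω (i : Tier) (n : ℕ) => g i n ω) P

section SINR

variable (p : Params) {Ω : Type*} (X : Tier → ℕ → Ω → Plane) (g : Tier → ℕ → Ω → ℝ)

/-- The received power `P_i |h|² r^{-α}` at the origin from the base station `b`, in `[0, ∞]`. -/
def rxPower (b : BS) (ω : Ω) : ℝ≥0∞ :=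
  ENNReal.ofReal (p.txPower b.1 * g b.1 b.2 ω) * ‖X b.1 b.2 ω‖ₑ ^ (-p.α)

/-- The SINR `γ_s` of the typical user when it is served by the base station `s`:
`P_F |h_s|² r_s^{-α} / (∑_{other F-APs} P_F |h|² r^{-α} + ∑_{RRHs} P_R |h|² r^{-α} + σ²)` if `s` is
an F-AP, and
`ζ P_R |h_s|² r_s^{-α} / (∑_{F-APs} P_F |h|² r^{-α} + υ ∑_{other RRHs} P_R |h|² r^{-α} + σ²)`
if `s` is an RRH. -/
def sinr (s : BS) (ω : Ω) : ℝ≥0∞ :=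
  ENNReal.ofReal (p.signalGain s.1) * rxPower p X g s ω /
    ((∑' b : {b : BS // b ≠ s}, ENNReal.ofReal (p.coupling s.1 b.1.1) * rxPower p X g b.1 ω) +
      ENNReal.ofReal p.noise)

/-- The supremum of the SINR over all base stations (almost surely a maximum). -/
def maxSinr (ω : Ω) : ℝ≥0∞ := ⨆ s : BS, sinr p X g s ω

/-- The success probability `S({η_i}, α)` of the minimal-delay policy: the probability that some
base station has an SINR exceeding the threshold of its tier. -/
def successProb [MeasurableSpace Ω] (P : Measure Ω) (η : Tier → ℝ) : ℝ≥0∞ :=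
  P {ω | ∃ s : BS, ENNReal.ofReal (η s.1) < sinr p X g s ω}

/-- `log₂ (1 + x)` for `x ∈ [0, ∞]`. -/
def log2OneAdd (x : ℝ≥0∞) : ℝ≥0∞ :=
  (ENNReal.log (1 + x)).toENNReal / ENNReal.ofReal (Real.log 2)

/-- The average ergodic rate `E[log₂ (1 + max_x γ_x)]`, as an expectation in `[0, ∞]`. -/
def ergodicRate [MeasurableSpace Ω] (P : Measure Ω) : ℝ≥0∞ :=
  ∫⁻ ω, log2OneAdd (maxSinr p X g ω) ∂P

end SINR

end

end FRAN

/-! Almost surely all received powers `W s` are positive and finite. Up to a constant factor, the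
SINR of `s` is at most the ratio of `W s` to the total power of the other stations. If the total
power diverges, this ratio vanishes for every `s`. Otherwise `W s` tends to `0` along the stations,
while the other stations contribute an amount bounded below, so the ratio tends to `0`. In both
cases all SINRs are finite and tend to `0`, hence their supremum is attained and finite. The rate
formulas are two forms of the layer cake formula, as the increasing map `x ↦ log₂ (1 + x)` sends
`2 ^ t - 1` to `t`. -/

namespace FRAN

open Filter Topology Function

theorem exists_forall_le_of_tendsto_cofinite {ι β : Type*} [LinearOrder β] [TopologicalSpace β]
    [OrderTopology β] {f : ι → β} {a : β} (hf : Tendsto f cofinite (𝓝 a)) {i₀ : ι}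
    (hi₀ : a ≤ f i₀) : ∃ s, ∀ i, f i ≤ f s := by
  by_cases hle : ∀ i, f i ≤ a
  · exact ⟨i₀, fun i => (hle i).trans hi₀⟩
  push Not at hle
  obtain ⟨j, hj⟩ := hle
  have hfin : {i | f j ≤ f i}.Finite := by
    simpa [eventually_cofinite] using hf.eventually (gt_mem_nhds hj)
  obtain ⟨s, hs, hmax⟩ := exists_max_image _ f hfin ⟨j, le_rfl⟩
  exact ⟨s, fun i => (le_total (f j) (f i)).elim (hmax i) fun h => h.trans hs⟩

section SignalToInterference

variable {ι : Type*} {W : ι → ℝ≥0∞}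

/-- The signal-to-interference ratio of the source `s` among sources with received powers `W`,
without noise and with unit couplings; a constant multiple of it dominates the SINR of a station. -/
noncomputable def sir (W : ι → ℝ≥0∞) (s : ι) : ℝ≥0∞ :=
  W s / ∑' b : {b // b ≠ s}, W b

theorem sir_eq_zero_of_tsum_eq_top {s : ι} (hs : W s ≠ ∞) (hW : ∑' i, W i = ∞) :
    sir W s = 0 := by
  have hsplit := ENNReal.summable.tsum_add_tsum_compl (f := W) (s := {s}) ENNReal.summable
  rw [hW, tsum_singleton s W, ENNReal.add_eq_top] at hsplit
  have hrest : ∑' b : {b // b ≠ s}, W b = ∞ := hsplit.resolve_left hs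
  rw [sir, hrest, ENNReal.div_top]

theorem exists_ne_zero_forall_le_tsum_ne (hW : (support W).Nontrivial) :
    ∃ m ≠ 0, ∀ s, m ≤ ∑' b : {b // b ≠ s}, W b.1 := by
  obtain ⟨u, hu, v, hv, huv⟩ := hW
  refine ⟨min (W u) (W v), (lt_min (pos_iff_ne_zero.2 hu) (pos_iff_ne_zero.2 hv)).ne',
    fun s => ?_⟩
  by_cases hus : u = s
  · exact (min_le_right _ _).trans
      (ENNReal.le_tsum (f := fun b : {b // b ≠ s} => W b.1) ⟨v, fun h => huv (hus.trans h.symm)⟩)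
  · exact (min_le_left _ _).trans
      (ENNReal.le_tsum (f := fun b : {b // b ≠ s} => W b.1) ⟨u, hus⟩)

theorem exists_ne_top_forall_sir_le_mul (hW : (support W).Nontrivial) :
    ∃ C ≠ ∞, ∀ s, sir W s ≤ C * W s := by
  obtain ⟨m, hm, hle⟩ := exists_ne_zero_forall_le_tsum_ne hW
  refine ⟨m⁻¹, ENNReal.inv_ne_top.2 hm, fun s => ?_⟩
  rw [mul_comm, ← div_eq_mul_inv]
  exact ENNReal.div_le_div_left (hle s) _

theorem sir_ne_top (hW : (support W).Nontrivial) {s : ι} (hs : W s ≠ ∞) : sir W s ≠ ∞ := by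
  obtain ⟨C, hC, hle⟩ := exists_ne_top_forall_sir_le_mul hW
  exact ne_top_of_le_ne_top (ENNReal.mul_ne_top hC hs) (hle s)

theorem tendsto_sir_cofinite_zero (hW : (support W).Nontrivial) (hfin : ∀ i, W i ≠ ∞) :
    Tendsto (sir W) cofinite (𝓝 0) := by
  by_cases htop : ∑' i, W i = ∞
  · have hzero : sir W = fun _ => 0 :=
      funext fun s => sir_eq_zero_of_tsum_eq_top (hfin s) htop
    exact hzero ▸ tendsto_const_nhds
  · obtain ⟨C, hC, hle⟩ := exists_ne_top_forall_sir_le_mul hW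
    have hCW : Tendsto (fun s => C * W s) cofinite (𝓝 0) := by
      simpa only [mul_zero] using
        ENNReal.Tendsto.const_mul (ENNReal.tendsto_cofinite_zero_of_tsum_ne_top htop) (Or.inr hC)
    exact tendsto_of_tendsto_of_tendsto_of_le_of_le tendsto_const_nhds hCW
      (fun _ => zero_le) hle

end SignalToInterference

section LayerCake

variable {Ω : Type*} [MeasurableSpace Ω] {μ : Measure Ω} {f : Ω → ℝ≥0∞}

theorem setLIntegral_Ioi_eq_top_of_forall_le {F : ℝ → ℝ≥0∞} {c : ℝ≥0∞} (hc : c ≠ 0)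
    (hF : ∀ t, c ≤ F t) (a : ℝ) : ∫⁻ t in Ioi a, F t = ∞ :=
  top_le_iff.1 <| calc
    ∞ = ∫⁻ _ in Ioi a, c := by simp [hc]
    _ ≤ ∫⁻ t in Ioi a, F t := lintegral_mono hF

theorem lintegral_eq_lintegral_meas_ofReal_lt (hf : AEMeasurable f μ) :
    ∫⁻ ω, f ω ∂μ = ∫⁻ t in Ioi (0 : ℝ), μ {ω | ENNReal.ofReal t < f ω} := by
  by_cases htop : μ {ω | f ω = ∞} = 0
  · have hfin : ∀ᵐ ω ∂μ, f ω ≠ ∞ := by simpa only [ae_iff, not_not] using htop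
    calc ∫⁻ ω, f ω ∂μ
      _ = ∫⁻ ω, ENNReal.ofReal (f ω).toReal ∂μ :=
        lintegral_congr_ae (hfin.mono fun ω hω => (ENNReal.ofReal_toReal hω).symm)
      _ = ∫⁻ t in Ioi (0 : ℝ), μ {ω | t < (f ω).toReal} :=
        lintegral_eq_lintegral_meas_lt μ (ae_of_all _ fun _ => ENNReal.toReal_nonneg)
          hf.ennreal_toReal
      _ = ∫⁻ t in Ioi (0 : ℝ), μ {ω | ENNReal.ofReal t < f ω} :=
        setLIntegral_congr_fun measurableSet_Ioi fun t ht => measure_congr <|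
          eventuallyEq_set.2 <| hfin.mono fun ω hω =>
            (ENNReal.ofReal_lt_iff_lt_toReal (le_of_lt ht) hω).symm
  · rw [lintegral_eq_top_of_measure_eq_top_ne_zero hf htop,
      setLIntegral_Ioi_eq_top_of_forall_le htop]
    refine fun t => measure_mono fun ω (hω : f ω = ∞) => ?_
    exact ENNReal.ofReal_lt_top.trans_eq hω.symm

theorem lintegral_eq_lintegral_meas_ofReal_le (hf : AEMeasurable f μ) :
    ∫⁻ ω, f ω ∂μ = ∫⁻ t in Ioi (0 : ℝ), μ {ω | ENNReal.ofReal t ≤ f ω} := by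
  have hcount : (Ioi (0 : ℝ) ∩ {t | μ {ω | ENNReal.ofReal t ≤ f ω} ≠
      μ {ω | ENNReal.ofReal t < f ω}}).Countable := by
    refine MapsTo.countable_of_injOn (f := ENNReal.ofReal) (fun t ht => ht.2) ?_
      (countable_meas_le_ne_meas_lt μ f)
    exact fun s hs t ht hst => (ENNReal.ofReal_eq_ofReal_iff hs.1.le ht.1.le).1 hst
  rw [lintegral_eq_lintegral_meas_ofReal_lt hf]
  refine setLIntegral_congr_fun_ae measurableSet_Ioi ?_
  filter_upwards [hcount.ae_notMem volume] with t ht ht0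
  by_contra hne
  exact ht ⟨ht0, Ne.symm hne⟩

end LayerCake

theorem expMeasure_Iic_of_nonpos (r : ℝ) {x : ℝ} (hx : x ≤ 0) : expMeasure r (Iic x) = 0 := by
  rw [expMeasure, gammaMeasure, withDensity_apply _ measurableSet_Iic,
    setLIntegral_congr Iio_ae_eq_Iic.symm]
  exact lintegral_gammaPDF_of_nonpos hx

namespace Params

variable (p : Params)

theorem txPower_pos (i : Tier) : 0 < p.txPower i := by
  cases i
  exacts [p.powF_pos, p.powF_pos, p.powR_pos]

theorem υ_pos : 0 < p.υ := Real.rpow_pos_of_pos two_pos _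

theorem signalGain_le (i : Tier) : p.signalGain i ≤ max p.ζ 1 := by
  cases i
  exacts [le_max_right _ _, le_max_right _ _, le_max_left _ _]

theorem le_coupling (i j : Tier) : min p.υ 1 ≤ p.coupling i j := by
  cases i <;> cases j <;> simp [coupling]

theorem α_pos : 0 < p.α := two_pos.trans p.two_lt_α

end Params

instance : Countable Tier :=
  Injective.countable (f := fun i : Tier => i.ctorIdx) fun i j => by
    cases i <;> cases j <;> simp [Tier.ctorIdx]

instance : Nonempty Tier := ⟨.cached⟩

section Realization

variable {p : Params} {Ω : Type*} {X : Tier → ℕ → Ω → Plane} {g : Tier → ℕ → Ω → ℝ} {ω : Ω}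

theorem rxPower_ne_zero {b : BS} (hg : 0 < g b.1 b.2 ω) : rxPower p X g b ω ≠ 0 := by
  refine mul_ne_zero (ENNReal.ofReal_pos.2 (mul_pos (p.txPower_pos _) hg)).ne' ?_
  simp [ENNReal.rpow_eq_zero_iff, p.α_pos.not_gt, p.α_pos]

theorem rxPower_ne_top {b : BS} (hX : X b.1 b.2 ω ≠ 0) : rxPower p X g b ω ≠ ∞ := by
  refine ENNReal.mul_ne_top ENNReal.ofReal_ne_top ?_
  simp [ENNReal.rpow_eq_top_iff, p.α_pos.not_gt, hX]

variable (p X g ω) in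
theorem exists_ne_top_forall_sinr_le_mul_sir :
    ∃ C ≠ ∞, ∀ s, sinr p X g s ω ≤ C * sir (fun b => rxPower p X g b ω) s := by
  set A := ENNReal.ofReal (max p.ζ 1)
  set c := ENNReal.ofReal (min p.υ 1)
  have hc : c ≠ 0 := (ENNReal.ofReal_pos.2 (lt_min p.υ_pos one_pos)).ne'
  refine ⟨A / c, ENNReal.div_ne_top ENNReal.ofReal_ne_top hc, fun s => ?_⟩
  have hsignal : ENNReal.ofReal (p.signalGain s.1) ≤ A :=
    ENNReal.ofReal_le_ofReal (p.signalGain_le _)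
  have hinterference : c * ∑' b : {b : BS // b ≠ s}, rxPower p X g b ω ≤
      ∑' b : {b : BS // b ≠ s}, ENNReal.ofReal (p.coupling s.1 b.1.1) * rxPower p X g b ω := by
    rw [← ENNReal.tsum_mul_left]
    gcongr with b
    exact ENNReal.ofReal_le_ofReal (p.le_coupling _ _)
  calc sinr p X g s ω
    _ ≤ A * rxPower p X g s ω / (c * ∑' b : {b : BS // b ≠ s}, rxPower p X g b ω) :=
      ENNReal.div_le_div (mul_le_mul_left hsignal _) (hinterference.trans le_self_add)
    _ = A / c * sir (fun b => rxPower p X g b ω) s :=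
      ENNReal.mul_div_mul_comm (Or.inl hc) (Or.inl ENNReal.ofReal_ne_top)

theorem maxSinr_lt_top_and_exists_sinr_eq_maxSinr (hX : ∀ b : BS, X b.1 b.2 ω ≠ 0)
    (hg : {b : BS | 0 < g b.1 b.2 ω}.Nontrivial) :
    maxSinr p X g ω < ∞ ∧ ∃ s, sinr p X g s ω = maxSinr p X g ω := by
  have hW : (support fun b => rxPower p X g b ω).Nontrivial :=
    hg.mono fun _ hb => rxPower_ne_zero hb
  have hfin : ∀ b, rxPower p X g b ω ≠ ∞ := fun b => rxPower_ne_top (hX b)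
  obtain ⟨C, hC, hle⟩ := exists_ne_top_forall_sinr_le_mul_sir p X g ω
  have hlim : Tendsto (fun s => sinr p X g s ω) cofinite (𝓝 0) := by
    refine tendsto_of_tendsto_of_tendsto_of_le_of_le tendsto_const_nhds ?_ (fun _ => zero_le) hle
    simpa only [mul_zero] using
      ENNReal.Tendsto.const_mul (tendsto_sir_cofinite_zero hW hfin) (Or.inr hC)
  obtain ⟨s, hs⟩ :=
    exists_forall_le_of_tendsto_cofinite hlim (i₀ := Classical.arbitrary BS) zero_le
  have hmax : sinr p X g s ω = maxSinr p X g ω :=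
    le_antisymm (le_iSup (fun s => sinr p X g s ω) s) (iSup_le hs)
  have hs_top : sinr p X g s ω ≠ ∞ :=
    ne_top_of_le_ne_top (ENNReal.mul_ne_top hC (sir_ne_top hW (hfin s))) (hle s)
  exact ⟨hmax ▸ hs_top.lt_top, s, hmax⟩

end Realization

section Measurability

variable {p : Params} {Ω : Type*} [MeasurableSpace Ω] {X : Tier → ℕ → Ω → Plane}
  {g : Tier → ℕ → Ω → ℝ}

theorem measurable_rxPower {b : BS} (hX : Measurable (X b.1 b.2)) (hg : Measurable (g b.1 b.2)) :
    Measurable (rxPower p X g b) := by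
  unfold rxPower
  fun_prop

theorem measurable_sinr (hX : ∀ i n, Measurable (X i n)) (hg : ∀ i n, Measurable (g i n))
    (s : BS) : Measurable (sinr p X g s) := by
  have hW : ∀ b : BS, Measurable (rxPower p X g b) := fun b => measurable_rxPower (hX _ _) (hg _ _)
  have hinterference : Measurable fun ω => ∑' b : {b : BS // b ≠ s},
      ENNReal.ofReal (p.coupling s.1 b.1.1) * rxPower p X g b ω :=
    Measurable.tsum fun b => (hW b).const_mul _
  exact ((hW s).const_mul _).div (hinterference.add_const _)

theorem measurable_maxSinr (hX : ∀ i n, Measurable (X i n)) (hg : ∀ i n, Measurable (g i n)) :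
    Measurable (maxSinr p X g) :=
  Measurable.iSup (measurable_sinr hX hg)

end Measurability

section Rate

theorem log2OneAdd_strictMono : StrictMono log2OneAdd := fun x y hxy => by
  have hlog2 : ENNReal.ofReal (Real.log 2) ≠ 0 :=
    (ENNReal.ofReal_pos.2 (Real.log_pos one_lt_two)).ne'
  refine ENNReal.div_lt_div_right hlog2 ENNReal.ofReal_ne_top ?_
  refine EReal.toENNReal_lt_toENNReal (ENNReal.zero_le_log_iff.2 le_self_add) ?_
  exact ENNReal.log_strictMono ((ENNReal.add_lt_add_iff_left ENNReal.one_ne_top).2 hxy)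

theorem log2OneAdd_ofReal_two_rpow_sub_one {t : ℝ} (ht : 0 ≤ t) :
    log2OneAdd (ENNReal.ofReal (2 ^ t - 1)) = ENNReal.ofReal t := by
  have hsub : (0 : ℝ) ≤ 2 ^ t - 1 := sub_nonneg.2 (Real.one_le_rpow one_le_two ht)
  have hlog2 : 0 < Real.log 2 := Real.log_pos one_lt_two
  rw [log2OneAdd, ← ENNReal.ofReal_one, ← ENNReal.ofReal_add zero_le_one hsub, add_sub_cancel,
    ENNReal.log_ofReal_of_pos (by positivity), Real.log_rpow two_pos,
    EReal.toENNReal_of_ne_top (EReal.coe_ne_top _), EReal.toReal_coe,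
    ← ENNReal.ofReal_div_of_pos hlog2, mul_div_cancel_right₀ _ hlog2.ne']

theorem measurable_log2OneAdd : Measurable log2OneAdd := log2OneAdd_strictMono.monotone.measurable

variable {p : Params} {Ω : Type*} [MeasurableSpace Ω] {P : Measure Ω}
  {X : Tier → ℕ → Ω → Plane} {g : Tier → ℕ → Ω → ℝ}

theorem ergodicRate_eq_lintegral_meas_le_maxSinr (h : AEMeasurable (maxSinr p X g) P) :
    ergodicRate p X g P =
      ∫⁻ t in Ioi (0 : ℝ), P {ω | ENNReal.ofReal ((2 : ℝ) ^ t - 1) ≤ maxSinr p X g ω} := by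
  have hrate : AEMeasurable (fun ω => log2OneAdd (maxSinr p X g ω)) P :=
    measurable_log2OneAdd.comp_aemeasurable h
  rw [ergodicRate, lintegral_eq_lintegral_meas_ofReal_le hrate]
  refine setLIntegral_congr_fun measurableSet_Ioi fun t (ht : 0 < t) => ?_
  simp only [← log2OneAdd_ofReal_two_rpow_sub_one ht.le,
    log2OneAdd_strictMono.le_iff_le]

theorem ergodicRate_eq_lintegral_successProb (h : AEMeasurable (maxSinr p X g) P) :
    ergodicRate p X g P =
      ∫⁻ t in Ioi (0 : ℝ), successProb p X g P (fun _ => (2 : ℝ) ^ t - 1) := by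
  have hrate : AEMeasurable (fun ω => log2OneAdd (maxSinr p X g ω)) P :=
    measurable_log2OneAdd.comp_aemeasurable h
  rw [ergodicRate, lintegral_eq_lintegral_meas_ofReal_lt hrate]
  refine setLIntegral_congr_fun measurableSet_Ioi fun t (ht : 0 < t) => ?_
  simp only [← log2OneAdd_ofReal_two_rpow_sub_one ht.le,
    log2OneAdd_strictMono.lt_iff_lt, successProb, maxSinr, lt_iSup_iff]

end Rate

section Network

variable {Ω : Type*} [MeasurableSpace Ω] {P : Measure Ω}

theorem IsPoissonProcess.ae_forall_ne [IsProbabilityMeasure P] {X : ℕ → Ω → Plane}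
    {ν : Measure Plane} (h : IsPoissonProcess X ν P) {x : Plane} (hx : ν {x} = 0) :
    ∀ᵐ ω ∂P, ∀ n, X n ω ≠ x := by
  have hmeas : MeasurableSet {ω | ∀ n, X n ω ≠ x} := by
    rw [ofPred_forall]
    exact MeasurableSet.iInter fun n => (h.measurable n (measurableSet_singleton x)).compl
  refine (mem_ae_iff_prob_eq_one hmeas).2 ?_
  have hlaw := h.law 1 (fun _ => {x}) (fun _ => 0) (fun _ => measurableSet_singleton x)
    (fun _ => Bornology.isBounded_singleton) (fun i j hij => (hij (Subsingleton.elim i j)).elim)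
  simpa [hx, poissonMeasure_singleton, Set.eq_empty_iff_forall_notMem] using hlaw

variable {p : Params} {X : Tier → ℕ → Ω → Plane} {g : Tier → ℕ → Ω → ℝ}

theorem IsNetwork.ae_forall_position_ne [IsProbabilityMeasure P] (h : IsNetwork p X g P)
    (x : Plane) : ∀ᵐ ω ∂P, ∀ b : BS, X b.1 b.2 ω ≠ x := by
  have hall := ae_all_iff.2 fun i => (h.poisson i).ae_forall_ne (x := x) (by simp)
  filter_upwards [hall] with ω hω b using hω b.1 b.2

theorem IsNetwork.ae_forall_gain_pos (h : IsNetwork p X g P) :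
    ∀ᵐ ω ∂P, ∀ b : BS, 0 < g b.1 b.2 ω := by
  refine ae_all_iff.2 fun b => ?_
  have hlaw := expMeasure_Iic_of_nonpos 1 le_rfl
  rw [← h.gain_law b.1 b.2, Measure.map_apply (h.gain_measurable _ _) measurableSet_Iic] at hlaw
  simp only [ae_iff, not_lt]
  exact hlaw

theorem IsNetwork.ae_nontrivial_gain_pos (h : IsNetwork p X g P) :
    ∀ᵐ ω ∂P, {b : BS | 0 < g b.1 b.2 ω}.Nontrivial := by
  filter_upwards [h.ae_forall_gain_pos] with ω hω
  exact nontrivial_univ.mono fun b _ => hω b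

end Network

end FRAN

theorem lemma6_general (p : FRAN.Params) {Ω : Type*} [MeasurableSpace Ω] (P : Measure Ω)
    (X : FRAN.Tier → ℕ → Ω → FRAN.Plane) (g : FRAN.Tier → ℕ → Ω → ℝ)
    (hX : ∀ i n, Measurable (X i n)) (hg : ∀ i n, Measurable (g i n))
    (hX_ne : ∀ᵐ ω ∂P, ∀ b : FRAN.BS, X b.1 b.2 ω ≠ 0)
    (hg_pos : ∀ᵐ ω ∂P, {b : FRAN.BS | 0 < g b.1 b.2 ω}.Nontrivial) :
    (∀ᵐ ω ∂P, FRAN.maxSinr p X g ω < ∞ ∧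
      ∃ s : FRAN.BS, FRAN.sinr p X g s ω = FRAN.maxSinr p X g ω) ∧
    FRAN.ergodicRate p X g P =
      ∫⁻ t in Ioi (0 : ℝ), P {ω | ENNReal.ofReal ((2 : ℝ) ^ t - 1) ≤ FRAN.maxSinr p X g ω} ∧
    FRAN.ergodicRate p X g P =
      ∫⁻ t in Ioi (0 : ℝ), FRAN.successProb p X g P (fun _ => (2 : ℝ) ^ t - 1) := by
  have hmeas := (FRAN.measurable_maxSinr (p := p) hX hg).aemeasurable (μ := P)
  refine ⟨?_, FRAN.ergodicRate_eq_lintegral_meas_le_maxSinr hmeas,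
    FRAN.ergodicRate_eq_lintegral_successProb hmeas⟩
  filter_upwards [hX_ne, hg_pos] with ω hXω hgω
  exact FRAN.maxSinr_lt_top_and_exists_sinr_eq_maxSinr hXω hgω

theorem lemma6 (p : FRAN.Params) {Ω : Type*} [MeasurableSpace Ω] (P : Measure Ω)
    [IsProbabilityMeasure P] (X : FRAN.Tier → ℕ → Ω → FRAN.Plane) (g : FRAN.Tier → ℕ → Ω → ℝ)
    (hnet : FRAN.IsNetwork p X g P) :
    (∀ᵐ ω ∂P, FRAN.maxSinr p X g ω < ∞ ∧
      ∃ s : FRAN.BS, FRAN.sinr p X g s ω = FRAN.maxSinr p X g ω) ∧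
    FRAN.ergodicRate p X g P =
      ∫⁻ t in Ioi (0 : ℝ), P {ω | ENNReal.ofReal ((2 : ℝ) ^ t - 1) ≤ FRAN.maxSinr p X g ω} ∧
    FRAN.ergodicRate p X g P =
      ∫⁻ t in Ioi (0 : ℝ), FRAN.successProb p X g P (fun _ => (2 : ℝ) ^ t - 1) :=
  lemma6_general p P X g (fun i => (hnet.poisson i).measurable) hnet.gain_measurable
    (hnet.ae_forall_position_ne 0) hnet.ae_nontrivial_gain_pos
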